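/- For $n\ge 0$ write $(q)_n=\prod_{k=1}^{n}(1-q^k)$ and, for $0\le n\le N$, $\left[\begin{matrix}N\\ n\end{matrix}\right]=\dfrac{(q)_N}{(q)_n(q)_{N-n}}$. Let $N\ge 0$ be an integer (empty sums are $0$). (i) Let $q$ be an element of a field with $q^k\neq 1$ for all $1\le k\le N$ (for example $q\in\mathbb{C}$ with $|q|<1$, or $q$ an indeterminate). Then $$\sum_{n=1}^{N}\frac{q^n}{1-q^n}+\sum_{n=1}^{N}\left[\begin{matrix}N\\ n\end{matrix}\right]\frac{q^{n(n+1)}}{(q)_n(1-q^n)}=\sum_{n=1}^{N}\frac{q^n}{(1-q^n)(q)_n}.$$ (ii) For every integer $m\ge 1$, $$d(m,N)+w(m,N)=\mathrm{lpt}(m,N),$$ where $d(m,N)$ is the number of positive divisors of $m$ that are at most $N$; $\mathrm{lpt}(m,N)$ is the total number of occurrences of the largest part, summed over all partitions of $m$ whose largest part is at most $N$; and $$w(m,N)=\sum_{n=1}^{N}\ \sum_{\pi}\bigl(\nu_\pi(n)+1\bigr),$$ the inner sum being over all partitions $\pi$ of $m$ with largest part at most $N+1$ and with exactly $n$ parts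 (counted with multiplicity) greater than $n$, and $\nu_\pi(n)$ being the number of occurrences of $n$ as a part of $\pi$. -/

import Mathlib

/-- The `q`-shifted factorial `(A; q)_n = (1 - A)(1 - Aq) ⋯ (1 - Aq^(n-1))`. -/
def qShiftedFactorial {K : Type*} [Field K] (A q : K) (n : ℕ) : K :=
  ∏ k ∈ Finset.range n, (1 - A * q ^ k)

/-- The `q`-binomial coefficient, `(q; q)_N / ((q; q)_n (q; q)_(N-n))` if `n ≤ N`, and `0`
otherwise. -/
def qBinomial {K : Type*} [Field K] (q : K) (N n : ℕ) : K :=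
  if n ≤ N then
    qShiftedFactorial q q N / (qShiftedFactorial q q n * qShiftedFactorial q q (N - n))
  else 0

/-- `d(m, N)`: the number of divisors of `m` that are at most `N` (used for `m ≥ 1`). -/
def divisorCountUpTo (m N : ℕ) : ℕ :=
  (m.divisors.filter (fun k => k ≤ N)).card

/-- The largest part of a partition (`0` for the empty partition). -/
def largestPart {m : ℕ} (π : m.Partition) : ℕ :=
  π.parts.sup

/-- `𝒫(m, N)`: the partitions of `m` whose largest part is at most `N`. -/
def partitionsUpTo (m N : ℕ) : Finset m.Partition :=
  Finset.univ.filter (fun π => largestPart π ≤ N)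

/-- `lpt(m, N)`: the total number of occurrences of the largest part, over all partitions of `m`
whose largest part is at most `N`. -/
def lptUpTo (m N : ℕ) : ℕ :=
  ∑ π ∈ partitionsUpTo m N, π.parts.count (largestPart π)

/-- `w(m, N)`: the sum over `1 ≤ n ≤ N`, and over the partitions `π` of `m` with largest part at
most `N + 1` and with exactly `n` parts (counted with multiplicity) greater than `n`, of the number
of occurrences of `n` in `π`, plus one. -/
def weightedCount (m N : ℕ) : ℕ :=
  ∑ n ∈ Finset.Icc 1 N,
    ∑ π ∈ (partitionsUpTo m (N + 1)).filter
        (fun π => Multiset.card (π.parts.filter (fun i => n < i)) = n),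
      (π.parts.count n + 1)

/-! Part (i) is by induction on `N`. Pascal's rule and absorption show that passing from `N` to `N +
1` multiplies the `n`-th term of the finite Durfee square sum (`sum_qBinomial_mul_pow_div` with `a =
0`) by `q ^ (N + 1) / (1 - q ^ (N + 1))`. That sum is `1 / (q)_(N+1)`, and its missing `n = 0` term
is supplied by the new divisor term, so the left side grows by exactly the new term on the right.

Part (ii) is the coefficient of `q ^ m` in part (i). The divisor series is clear. On the right, `1 /
((q)_n (1 - q ^ n))` counts partitions into parts at most `n` with weight `ν(n) + 1`; removing `1 /
(q)_n` leaves weight `ν(n)`. On the left, the same series is multiplied by that of `n` parts in `(n,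
N + 1]`, which is `q ^ (n * (n + 1))` times a `q`-binomial coefficient (`map_boxSeries`). The
identities are compared in a field containing `ℤ⟦X⟧`, with `q = X`. -/

/-! ### q-binomial coefficients and the identity (i) -/

theorem qShiftedFactorial_self_succ {K : Type*} [Field K] (q : K) (n : ℕ) :
    qShiftedFactorial q q (n + 1) = qShiftedFactorial q q n * (1 - q ^ (n + 1)) := by
  simp only [qShiftedFactorial, Finset.prod_range_succ, pow_succ']

theorem qShiftedFactorial_self_ne_zero {K : Type*} [Field K] {q : K} {N : ℕ}
    (hq : ∀ k : ℕ, 1 ≤ k → k ≤ N → q ^ k ≠ 1) {n : ℕ} (hn : n ≤ N) :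
    qShiftedFactorial q q n ≠ 0 := by
  refine Finset.prod_ne_zero_iff.2 fun k hk => ?_
  rw [← pow_succ', sub_ne_zero]
  exact (hq (k + 1) (by omega) (by have := Finset.mem_range.1 hk; omega)).symm

theorem qBinomial_eq_zero_of_lt {K : Type*} [Field K] (q : K) {N n : ℕ} (h : N < n) :
    qBinomial q N n = 0 := if_neg (by omega)

theorem qBinomial_zero_right {K : Type*} [Field K] {q : K} {N : ℕ}
    (hq : ∀ k : ℕ, 1 ≤ k → k ≤ N → q ^ k ≠ 1) : qBinomial q N 0 = 1 := by
  have := qShiftedFactorial_self_ne_zero hq le_rfl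
  simp only [qBinomial, qShiftedFactorial, Nat.zero_le, if_true, Finset.range_zero,
    Finset.prod_empty, one_mul, Nat.sub_zero] at this ⊢
  exact div_self this

theorem qBinomial_self {K : Type*} [Field K] {q : K} {N : ℕ}
    (hq : ∀ k : ℕ, 1 ≤ k → k ≤ N → q ^ k ≠ 1) : qBinomial q N N = 1 := by
  have := qShiftedFactorial_self_ne_zero hq le_rfl
  simp only [qBinomial, le_refl, if_true, Nat.sub_self]
  rw [show qShiftedFactorial q q 0 = 1 from Finset.prod_range_zero _, mul_one]
  exact div_self this

/-- The `q`-analogue of Pascal's rule. -/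
theorem qBinomial_succ_succ {K : Type*} [Field K] {q : K} {N n : ℕ}
    (hq : ∀ k : ℕ, 1 ≤ k → k ≤ N + 1 → q ^ k ≠ 1) (hn : n ≤ N) :
    qBinomial q (N + 1) (n + 1) = qBinomial q N (n + 1) + q ^ (N - n) * qBinomial q N n := by
  have hq' : ∀ k : ℕ, 1 ≤ k → k ≤ N → q ^ k ≠ 1 := fun k h1 h2 => hq k h1 (by omega)
  obtain ⟨d, rfl⟩ := Nat.exists_eq_add_of_le hn
  rcases d with _ | d
  · simp only [Nat.add_zero, Nat.sub_self, pow_zero] at *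
    rw [qBinomial_self hq, qBinomial_self hq', qBinomial_eq_zero_of_lt q (Nat.lt_succ_self n)]
    ring
  · have h1 := qShiftedFactorial_self_ne_zero hq (n := n) (by omega)
    have h2 := qShiftedFactorial_self_ne_zero hq (n := d) (by omega)
    have h3 : (1 - q ^ (n + 1)) ≠ 0 := sub_ne_zero.2 (hq _ (by omega) (by omega)).symm
    have h4 : (1 - q ^ (d + 1)) ≠ 0 := sub_ne_zero.2 (hq _ (by omega) (by omega)).symm
    simp only [qBinomial]
    rw [if_pos (by omega), if_pos (by omega), if_pos (by omega),
      show n + (d + 1) + 1 - (n + 1) = d + 1 by omega, show n + (d + 1) - (n + 1) = d by omega,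
      show n + (d + 1) - n = d + 1 by omega, qShiftedFactorial_self_succ q (n + (d + 1)),
      qShiftedFactorial_self_succ q n, qShiftedFactorial_self_succ q d]
    field_simp
    ring

/-- The absorption rule for `q`-binomial coefficients. -/
theorem qBinomial_succ_succ_mul {K : Type*} [Field K] {q : K} {N n : ℕ}
    (hq : ∀ k : ℕ, 1 ≤ k → k ≤ N + 1 → q ^ k ≠ 1) (hn : n ≤ N) :
    qBinomial q (N + 1) (n + 1) * (1 - q ^ (n + 1)) = qBinomial q N n * (1 - q ^ (N + 1)) := by
  have h1 := qShiftedFactorial_self_ne_zero hq (n := n) (by omega)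
  have h2 := qShiftedFactorial_self_ne_zero hq (n := N - n) (by omega)
  have h3 : (1 - q ^ (n + 1)) ≠ 0 := sub_ne_zero.2 (hq _ (by omega) (by omega)).symm
  simp only [qBinomial]
  rw [if_pos (by omega), if_pos hn, show N + 1 - (n + 1) = N - n by omega,
    qShiftedFactorial_self_succ q N, qShiftedFactorial_self_succ q n]
  field_simp

/-- A finite form of the Durfee rectangle identity. -/
theorem sum_qBinomial_mul_pow_div {K : Type*} [Field K] {q : K} (N a : ℕ)
    (hq : ∀ k : ℕ, 1 ≤ k → k ≤ N + a → q ^ k ≠ 1) :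
    ∑ n ∈ Finset.range (N + 1),
        qBinomial q N n * (q ^ (n * (n + a)) / qShiftedFactorial q q (n + a)) =
      1 / qShiftedFactorial q q (N + a) := by
  induction N generalizing a with
  | zero =>
    simp [qBinomial_self (q := q) (N := 0) (by omega)]
  | succ N ih =>
    have ih1 := ih a fun k h1 h2 => hq k h1 (by omega)
    have ih2 := ih (a + 1) fun k h1 h2 => hq k h1 (by omega)
    have hqN : ∀ k : ℕ, 1 ≤ k → k ≤ N + 1 → q ^ k ≠ 1 := fun k h1 h2 => hq k h1 (by omega)
    have hqN' : ∀ k : ℕ, 1 ≤ k → k ≤ N → q ^ k ≠ 1 := fun k h1 h2 => hq k h1 (by omega)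
    -- Pascal's rule; after shifting `n`, the exponents match because `(N - n) + (n + 1)(n + 1 + a)
    -- = (N + 1 + a) + n(n + a + 1)`. This raises `a`, hence the induction for all `a`.
    have hsplit : ∑ n ∈ Finset.range (N + 1 + 1),
          qBinomial q (N + 1) n * (q ^ (n * (n + a)) / qShiftedFactorial q q (n + a)) =
        ∑ n ∈ Finset.range (N + 1),
            qBinomial q N n * (q ^ (n * (n + a)) / qShiftedFactorial q q (n + a)) +
          q ^ (N + 1 + a) * ∑ n ∈ Finset.range (N + 1), qBinomial q N n *
            (q ^ (n * (n + (a + 1))) / qShiftedFactorial q q (n + (a + 1))) := by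
      have hext : ∑ n ∈ Finset.range (N + 1),
            qBinomial q N n * (q ^ (n * (n + a)) / qShiftedFactorial q q (n + a)) =
          ∑ n ∈ Finset.range (N + 1 + 1),
            qBinomial q N n * (q ^ (n * (n + a)) / qShiftedFactorial q q (n + a)) := by
        rw [Finset.sum_range_succ _ (N + 1), qBinomial_eq_zero_of_lt q (Nat.lt_succ_self N),
          zero_mul, add_zero]
      rw [hext, Finset.sum_range_succ', Finset.sum_range_succ' _ (N + 1),
        qBinomial_zero_right hqN, qBinomial_zero_right hqN', Finset.mul_sum, add_right_comm,
        ← Finset.sum_add_distrib]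
      congr 1
      refine Finset.sum_congr rfl fun n hn => ?_
      have hn' : n ≤ N := by have := Finset.mem_range.1 hn; omega
      rw [qBinomial_succ_succ hqN hn', show n + (a + 1) = n + 1 + a by omega]
      obtain ⟨d, rfl⟩ := Nat.exists_eq_add_of_le hn'
      rw [show n + d - n = d by omega]
      ring
    have h1 := qShiftedFactorial_self_ne_zero hq (n := N + a) (by omega)
    have h3 : (1 - q ^ (N + a + 1)) ≠ 0 := sub_ne_zero.2 (hq _ (by omega) (by omega)).symm
    rw [hsplit, ih1, ih2, show N + (a + 1) = N + a + 1 by omega,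
      show N + 1 + a = N + a + 1 by omega, qShiftedFactorial_self_succ]
    field_simp
    ring

theorem sum_div_add_sum_qBinomial {K : Type*} [Field K] {q : K} (N : ℕ)
    (hq : ∀ k : ℕ, 1 ≤ k → k ≤ N → q ^ k ≠ 1) :
    ∑ n ∈ Finset.Icc 1 N, q ^ n / (1 - q ^ n) +
        ∑ n ∈ Finset.Icc 1 N,
          qBinomial q N n * (q ^ (n * (n + 1)) / (qShiftedFactorial q q n * (1 - q ^ n))) =
      ∑ n ∈ Finset.Icc 1 N, q ^ n / ((1 - q ^ n) * qShiftedFactorial q q n) := by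
  have hIcc (f : ℕ → K) (M : ℕ) :
      ∑ n ∈ Finset.Icc 1 M, f n = ∑ n ∈ Finset.range M, f (n + 1) := by
    rw [Finset.range_eq_Ico, Finset.sum_Ico_add' f 0 M 1]
    rfl
  simp only [hIcc]
  induction N with
  | zero => simp
  | succ N ih =>
    have ih := ih fun k h1 h2 => hq k h1 (by omega)
    have hN : (1 - q ^ (N + 1)) ≠ 0 := sub_ne_zero.2 (hq _ (by omega) (by omega)).symm
    have hdur := sum_qBinomial_mul_pow_div (N + 1) 0 hq
    rw [Finset.sum_range_succ', qBinomial_zero_right hq] at hdur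
    -- The Pascal increment, rewritten by absorption, contains a factor `1 - q ^ (n + 1)` that
    -- cancels the one in the denominator, leaving a Durfee term.
    have hstep : ∑ n ∈ Finset.range (N + 1), qBinomial q (N + 1) (n + 1) *
          (q ^ ((n + 1) * (n + 1 + 1)) /
            (qShiftedFactorial q q (n + 1) * (1 - q ^ (n + 1)))) =
        ∑ n ∈ Finset.range N, qBinomial q N (n + 1) *
          (q ^ ((n + 1) * (n + 1 + 1)) /
            (qShiftedFactorial q q (n + 1) * (1 - q ^ (n + 1)))) +
        q ^ (N + 1) / (1 - q ^ (N + 1)) * ∑ n ∈ Finset.range (N + 1),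
          qBinomial q (N + 1) (n + 1) *
            (q ^ ((n + 1) * (n + 1 + 0)) / qShiftedFactorial q q (n + 1 + 0)) := by
      have hext : ∑ n ∈ Finset.range N, qBinomial q N (n + 1) *
          (q ^ ((n + 1) * (n + 1 + 1)) /
            (qShiftedFactorial q q (n + 1) * (1 - q ^ (n + 1)))) =
          ∑ n ∈ Finset.range (N + 1), qBinomial q N (n + 1) *
          (q ^ ((n + 1) * (n + 1 + 1)) /
            (qShiftedFactorial q q (n + 1) * (1 - q ^ (n + 1)))) := by
        rw [Finset.sum_range_succ _ N, qBinomial_eq_zero_of_lt q (Nat.lt_succ_self N),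
          zero_mul, add_zero]
      rw [hext, Finset.mul_sum, ← Finset.sum_add_distrib]
      refine Finset.sum_congr rfl fun n hn => ?_
      have hn' : n ≤ N := by have := Finset.mem_range.1 hn; omega
      have h1 := qShiftedFactorial_self_ne_zero hq (n := n + 1) (by omega)
      have h3 : (1 - q ^ (n + 1)) ≠ 0 := sub_ne_zero.2 (hq _ (by omega) (by omega)).symm
      have habs : qBinomial q (N + 1) (n + 1) =
          qBinomial q N n * (1 - q ^ (N + 1)) / (1 - q ^ (n + 1)) :=
        (eq_div_iff h3).2 (qBinomial_succ_succ_mul hq hn')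
      have hpas : qBinomial q N (n + 1) =
          qBinomial q (N + 1) (n + 1) - q ^ (N - n) * qBinomial q N n :=
        eq_sub_of_add_eq (qBinomial_succ_succ hq hn').symm
      rw [hpas, habs]
      obtain ⟨d, rfl⟩ := Nat.exists_eq_add_of_le hn'
      rw [show n + d - n = d by omega, Nat.add_zero]
      field_simp
      ring
    rw [Finset.sum_range_succ, Finset.sum_range_succ (fun n => q ^ (n + 1) / _) N, hstep,
      ← ih, eq_sub_of_add_eq hdur]
    have h1 := qShiftedFactorial_self_ne_zero hq (n := N + 1) le_rfl
    simp only [Nat.zero_mul, pow_zero, Nat.add_zero,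
      show qShiftedFactorial q q 0 = 1 from Finset.prod_range_zero _]
    field_simp
    ring

/-! ### Partition generating functions as finite products -/

/-- The power series `∑ c, a c * X ^ (i * c)`. -/
noncomputable def multipleSeries {R : Type*} [CommRing R] (a : ℕ → R) (i : ℕ) : PowerSeries R :=
  PowerSeries.mk fun d => if i ∣ d then a (d / i) else 0

theorem one_add_tsum_eq_multipleSeries {R : Type*} [CommRing R] [TopologicalSpace R] [T2Space R]
    {a : ℕ → R} (h0 : a 0 = 1) {i : ℕ} (hi : i ≠ 0) :
    letI := PowerSeries.WithPiTopology.instTopologicalSpace R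
    (1 + ∑' j, a (j + 1) • (PowerSeries.X : PowerSeries R) ^ (i * (j + 1))) =
      multipleSeries a i := by
  let _ := PowerSeries.WithPiTopology.instTopologicalSpace R
  ext d
  rw [map_add, (Nat.Partition.summable_genFun_term' (fun _ => a) hi).map_tsum _
    (PowerSeries.WithPiTopology.continuous_coeff _ _), multipleSeries, PowerSeries.coeff_mk]
  simp only [map_smul, PowerSeries.coeff_X_pow, PowerSeries.coeff_one,
    smul_eq_mul, mul_ite, mul_one, mul_zero]
  split_ifs with hd hid hid
  · subst hd
    have : ∀ j, ¬ (0 = i * (j + 1)) := fun j h => by simp [hi] at h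
    simp [this, h0]
  · simp [hd] at hid
  · obtain ⟨c, rfl⟩ := hid
    have hc : c ≠ 0 := by rintro rfl; simp at hd
    rw [tsum_eq_single (c - 1), Nat.sub_add_cancel (by omega), if_pos rfl,
      Nat.mul_div_cancel_left _ (by omega), zero_add]
    intro b hb
    rw [if_neg]
    intro h
    have := Nat.eq_of_mul_eq_mul_left (by omega) h
    omega
  · have : ∀ j, ¬ (d = i * (j + 1)) := fun j h => hid ⟨_, h⟩
    simp [this]

theorem genFun_eq_prod_multipleSeries {R : Type*} [CommRing R] {f : ℕ → ℕ → R} {M : ℕ}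
    (h0 : ∀ i, 1 ≤ i → i ≤ M → f i 0 = 1) (hM : ∀ i, M < i → ∀ c, f i (c + 1) = 0) :
    Nat.Partition.genFun f = ∏ i ∈ Finset.Icc 1 M, multipleSeries (f i) i := by
  -- Any Hausdorff topology serves to identify the infinite product, all but finitely many of whose
  -- factors are `1`.
  let _ : TopologicalSpace R := ⊥
  have _ : DiscreteTopology R := ⟨rfl⟩
  let _ := PowerSeries.WithPiTopology.instTopologicalSpace R
  have _ : T2Space (PowerSeries R) := PowerSeries.WithPiTopology.instT2Space R
  have h := Nat.Partition.hasProd_genFun f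
  have h' := hasProd_prod_of_ne_finset_one (L := SummationFilter.unconditional ℕ)
    (f := fun i ↦ (1 + ∑' j, f (i + 1) (j + 1) •
      (PowerSeries.X : PowerSeries R) ^ ((i + 1) * (j + 1)))) (s := Finset.range M) (by
    intro i hi
    have hi' : M < i + 1 := by simpa [Nat.lt_succ_iff] using hi
    simp [hM _ hi'])
  rw [h.unique h', ← Finset.Ico_add_one_right_eq_Icc,
    Finset.prod_Ico_eq_prod_range, Nat.add_sub_cancel]
  refine Finset.prod_congr rfl fun i hi => ?_
  have hi' := Finset.mem_range.1 hi
  rw [Nat.add_comm 1 i]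
  exact one_add_tsum_eq_multipleSeries (h0 _ (by omega) (by omega)) (by omega)

/-- Turns a first-order recurrence for the coefficients into a closed form, without inverting
series. -/
theorem multipleSeries_mul_one_sub {R : Type*} [CommRing R] {a b : ℕ → R} {z : R} {i : ℕ}
    (hi : i ≠ 0) (h0 : a 0 = b 0) (hs : ∀ c, a (c + 1) = z * a c + b (c + 1)) :
    multipleSeries a i * (1 - PowerSeries.C z * PowerSeries.X ^ i) = multipleSeries b i := by
  ext d
  rw [mul_sub, mul_one, mul_left_comm, map_sub, PowerSeries.coeff_C_mul,
    PowerSeries.coeff_mul_X_pow']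
  simp only [multipleSeries, PowerSeries.coeff_mk]
  by_cases hid : i ∣ d
  · obtain ⟨c, rfl⟩ := hid
    rcases c with _ | c
    · simp [h0, hi]
    · have h : i * (c + 1) - i = i * c := by rw [Nat.mul_succ, Nat.add_sub_cancel]
      rw [if_pos (dvd_mul_right _ _), if_pos (Nat.le_mul_of_pos_right _ (by omega)), h,
        if_pos (dvd_mul_right _ _), if_pos (dvd_mul_right _ _),
        Nat.mul_div_cancel_left _ (by omega), Nat.mul_div_cancel_left _ (by omega), hs]
      ring
  · rw [if_neg hid, if_neg hid]
    split_ifs with h1 h2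
    · exact absurd ((Nat.dvd_sub_iff_left h1 dvd_rfl).1 h2) hid
    · simp
    · simp

theorem multipleSeries_pow_mul {R : Type*} [CommRing R] (z : R) {i : ℕ} (hi : i ≠ 0) :
    multipleSeries (fun c => z ^ c) i * (1 - PowerSeries.C z * PowerSeries.X ^ i) = 1 := by
  rw [multipleSeries_mul_one_sub (b := fun c => if c = 0 then 1 else 0) hi (by simp)
    (fun c => by simp [pow_succ'])]
  ext d
  simp only [multipleSeries, PowerSeries.coeff_mk, PowerSeries.coeff_one]
  by_cases hid : i ∣ d
  · obtain ⟨c, rfl⟩ := hid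
    rw [Nat.mul_div_cancel_left _ (by omega)]
    simp [hi]
  · have : d ≠ 0 := by rintro rfl; simp at hid
    simp [hid, this]

theorem multipleSeries_one_mul {R : Type*} [CommRing R] {i : ℕ} (hi : i ≠ 0) :
    multipleSeries (fun _ => (1 : R)) i * (1 - PowerSeries.X ^ i) = 1 := by
  simpa using multipleSeries_pow_mul (1 : R) hi

theorem multipleSeries_succ_mul {R : Type*} [CommRing R] {i : ℕ} (hi : i ≠ 0) :
    multipleSeries (fun c => (c : R) + 1) i * (1 - PowerSeries.X ^ i) =
      multipleSeries (fun _ => (1 : R)) i := by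
  simpa using multipleSeries_mul_one_sub (a := fun c => (c : R) + 1) (b := fun _ => (1 : R))
    (z := 1) hi (by simp) (fun c => by push_cast; ring)

theorem map_multipleSeries {R S : Type*} [CommRing R] [CommRing S] (φ : R →+* S) (a : ℕ → R)
    (i : ℕ) : PowerSeries.map φ (multipleSeries a i) = multipleSeries (fun c => φ (a c)) i := by
  ext d
  simp only [multipleSeries, PowerSeries.coeff_map, PowerSeries.coeff_mk]
  split_ifs <;> simp

/-! ### Counting parts with a marking variable -/

/-- Extraction of the coefficient of `z ^ k` from a power series over polynomials in `z`. -/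
noncomputable def polyCoeff {R : Type*} [CommRing R] (k : ℕ) :
    PowerSeries (Polynomial R) →+ PowerSeries R where
  toFun F := PowerSeries.mk fun m => (PowerSeries.coeff m F).coeff k
  map_zero' := by ext; simp
  map_add' F G := by ext; simp

theorem coeff_polyCoeff {R : Type*} [CommRing R] (k m : ℕ) (F : PowerSeries (Polynomial R)) :
    PowerSeries.coeff m (polyCoeff k F) = (PowerSeries.coeff m F).coeff k := by
  simp [polyCoeff]

theorem polyCoeff_map_C_mul {R : Type*} [CommRing R] (k : ℕ) (A : PowerSeries R)
    (F : PowerSeries (Polynomial R)) :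
    polyCoeff k (PowerSeries.map Polynomial.C A * F) = A * polyCoeff k F := by
  ext m
  simp [coeff_polyCoeff, PowerSeries.coeff_mul]

theorem polyCoeff_succ_C_X_mul {R : Type*} [CommRing R] (k : ℕ)
    (F : PowerSeries (Polynomial R)) :
    polyCoeff (k + 1) (PowerSeries.C Polynomial.X * F) = polyCoeff k F := by
  ext m
  simp [coeff_polyCoeff]

theorem polyCoeff_zero_C_X_mul {R : Type*} [CommRing R] (F : PowerSeries (Polynomial R)) :
    polyCoeff 0 (PowerSeries.C Polynomial.X * F) = 0 := by
  ext m
  simp [coeff_polyCoeff]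

theorem polyCoeff_one {R : Type*} [CommRing R] (k : ℕ) :
    polyCoeff k (1 : PowerSeries (Polynomial R)) = if k = 0 then 1 else 0 := by
  ext m
  rw [coeff_polyCoeff, PowerSeries.coeff_one]
  split_ifs with h1 h2 h2 <;> simp [Polynomial.coeff_one, PowerSeries.coeff_one, h1, h2]

/-- The generating function of the multisets of `k` integers in `(n, n + L]`, by their sum. -/
noncomputable def boxSeries (n k L : ℕ) : PowerSeries ℤ :=
  polyCoeff k (∏ i ∈ Finset.Ioc n (n + L),
    multipleSeries (fun c => (Polynomial.X : Polynomial ℤ) ^ c) i)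

/-- Either the part `n + L + 1` is absent, or one copy of it can be removed. -/
theorem prod_Ioc_succ_multipleSeries (n L : ℕ) :
    ∏ i ∈ Finset.Ioc n (n + (L + 1)),
        multipleSeries (fun c => (Polynomial.X : Polynomial ℤ) ^ c) i =
      ∏ i ∈ Finset.Ioc n (n + L),
        multipleSeries (fun c => (Polynomial.X : Polynomial ℤ) ^ c) i +
      PowerSeries.map Polynomial.C (PowerSeries.X ^ (n + L + 1)) *
        (PowerSeries.C Polynomial.X * ∏ i ∈ Finset.Ioc n (n + (L + 1)),
          multipleSeries (fun c => (Polynomial.X : Polynomial ℤ) ^ c) i) := by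
  rw [show n + (L + 1) = n + L + 1 by omega, Finset.prod_Ioc_succ_top (by omega), map_pow,
    PowerSeries.map_X]
  have h := multipleSeries_pow_mul (Polynomial.X : Polynomial ℤ) (Nat.succ_ne_zero (n + L))
  simp only [Nat.succ_eq_add_one] at h
  linear_combination (∏ i ∈ Finset.Ioc n (n + L),
        multipleSeries (fun c => (Polynomial.X : Polynomial ℤ) ^ c) i) * h

theorem boxSeries_zero_right (n k : ℕ) : boxSeries n k 0 = if k = 0 then 1 else 0 := by
  simp [boxSeries, polyCoeff_one]

theorem boxSeries_zero_succ (n L : ℕ) : boxSeries n 0 (L + 1) = boxSeries n 0 L := by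
  rw [boxSeries, prod_Ioc_succ_multipleSeries, map_add, polyCoeff_map_C_mul,
    polyCoeff_zero_C_X_mul, mul_zero, add_zero, boxSeries]

theorem boxSeries_succ_succ (n k L : ℕ) :
    boxSeries n (k + 1) (L + 1) =
      boxSeries n (k + 1) L + PowerSeries.X ^ (n + L + 1) * boxSeries n k (L + 1) := by
  rw [boxSeries, prod_Ioc_succ_multipleSeries, map_add, polyCoeff_map_C_mul,
    polyCoeff_succ_C_X_mul, boxSeries, boxSeries]

/-- The recurrence of `boxSeries_succ_succ` is Pascal's rule. For `k = L = 0` the subtraction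
truncates, harmlessly, since the lower index is `0`. -/
theorem map_boxSeries {K : Type*} [Field K] (ι : PowerSeries ℤ →+* K) {q : K}
    (hι : ι PowerSeries.X = q) (hq : ∀ k : ℕ, 1 ≤ k → q ^ k ≠ 1) (n k L : ℕ) :
    ι (boxSeries n k L) = q ^ (k * (n + 1)) * qBinomial q (L + k - 1) k := by
  induction k generalizing L with
  | zero =>
    rw [qBinomial_zero_right fun k h1 _ => hq k h1, Nat.zero_mul, pow_zero, mul_one]
    induction L with
    | zero => simp [boxSeries_zero_right]
    | succ L ihL => rw [boxSeries_zero_succ, ihL]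
  | succ k ihk =>
    induction L with
    | zero =>
      rw [boxSeries_zero_right, qBinomial_eq_zero_of_lt q (by omega)]
      simp
    | succ L ihL =>
      rw [boxSeries_succ_succ, map_add, map_mul, map_pow, hι, ihL, ihk,
        show L + 1 + (k + 1) - 1 = L + k + 1 by omega, show L + (k + 1) - 1 = L + k by omega,
        show L + 1 + k - 1 = L + k by omega,
        qBinomial_succ_succ (fun k h1 _ => hq k h1) (by omega), show L + k - k = L by omega]
      ring

/-! ### Weighted partition counts as coefficients -/

/-- The weight of a part `i` occurring `c` times: it marks the occurrences of parts in `(n, M]` by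
powers of `z`, counts those of `n`, and excludes the parts greater than `M`. -/
def partWeight {R : Type*} [CommRing R] (z : R) (n M i c : ℕ) : R :=
  if i < n then 1 else if i = n then c + 1 else if i ≤ M then z ^ c else 0

theorem mem_partitionsUpTo {m N : ℕ} {π : m.Partition} :
    π ∈ partitionsUpTo m N ↔ ∀ i ∈ π.parts, i ≤ N := by
  simp [partitionsUpTo, largestPart]

theorem prod_partWeight {R : Type*} [CommRing R] (z : R) {n M : ℕ} (s : Multiset ℕ)
    (hs : ∀ i ∈ s, i ≤ M) :
    s.toFinsupp.prod (partWeight z n M) =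
      ((s.count n : R) + 1) * z ^ Multiset.card (s.filter (fun i => n < i)) := by
  have hsplit : ∀ i ∈ s.toFinset, partWeight z n M i (s.count i) =
      (if i = n then (s.count n : R) + 1 else 1) * z ^ (if n < i then s.count i else 0) := by
    intro i hi
    have := hs i (Multiset.mem_toFinset.1 hi)
    rcases lt_trichotomy i n with h | rfl | h
    · simp [partWeight, h, h.ne, h.not_gt]
    · simp [partWeight]
    · simp [partWeight, h, h.ne', h.not_gt, this]
  have hcard : Multiset.card (s.filter (fun i => n < i)) =
      ∑ i ∈ s.toFinset, if n < i then s.count i else 0 := by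
    rw [← Multiset.sum_count_eq_card (s := s.toFinset)
      (fun a ha => Multiset.mem_toFinset.2 (Multiset.mem_of_mem_filter ha))]
    exact Finset.sum_congr rfl fun i _ => Multiset.count_filter
  simp only [Finsupp.prod, Multiset.toFinsupp_support, Multiset.toFinsupp_apply]
  rw [Finset.prod_congr rfl hsplit, Finset.prod_mul_distrib, Finset.prod_pow_eq_pow_sum, ← hcard,
    Finset.prod_ite_eq']
  split_ifs with h
  · rfl
  -- If `n` is not a part, the product has no factor for it, in agreement with `0 + 1 = 1`.
  · rw [Multiset.count_eq_zero_of_notMem (by simpa using h)]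
    simp

theorem prod_eq_zero_of_notMem_partitionsUpTo {R : Type*} [CommRing R] {f : ℕ → ℕ → R} {m M : ℕ}
    (hM : ∀ i, M < i → ∀ c, f i c = 0) {π : m.Partition} (hπ : π ∉ partitionsUpTo m M) :
    π.parts.toFinsupp.prod f = 0 := by
  rw [mem_partitionsUpTo] at hπ
  push Not at hπ
  obtain ⟨i, hi, hlt⟩ := hπ
  exact Finset.prod_eq_zero (i := i) (by simpa using hi) (hM i hlt _)

theorem coeff_genFun_eq_sum_partitionsUpTo {R : Type*} [CommRing R] {f : ℕ → ℕ → R} {M : ℕ}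
    (hM : ∀ i, M < i → ∀ c, f i c = 0) (m : ℕ) :
    PowerSeries.coeff m (Nat.Partition.genFun f) =
      ∑ π ∈ partitionsUpTo m M, π.parts.toFinsupp.prod f := by
  rw [Nat.Partition.coeff_genFun]
  exact (Finset.sum_subset (Finset.subset_univ _)
    fun π _ hπ => prod_eq_zero_of_notMem_partitionsUpTo hM hπ).symm

theorem partWeight_eq_zero {R : Type*} [CommRing R] (z : R) {n M i : ℕ} (hnM : n ≤ M)
    (hi : M < i) (c : ℕ) : partWeight z n M i c = 0 := by
  rw [partWeight, if_neg (by omega), if_neg (by omega), if_neg (by omega)]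

/-- The generating function of the partitions with parts at most `n`, each counted with the number
of occurrences of `n`, plus one. -/
noncomputable def succCountSeries (n : ℕ) : PowerSeries ℤ :=
  (∏ i ∈ Finset.Ico 1 n, multipleSeries (fun _ => 1) i) * multipleSeries (fun c => (c : ℤ) + 1) n

theorem genFun_partWeight (n M : ℕ) (hn : 1 ≤ n) (hnM : n ≤ M) :
    Nat.Partition.genFun (partWeight (Polynomial.X : Polynomial ℤ) n M) =
      PowerSeries.map Polynomial.C (succCountSeries n) * ∏ i ∈ Finset.Ioc n M,
        multipleSeries (fun c => (Polynomial.X : Polynomial ℤ) ^ c) i := by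
  rw [genFun_eq_prod_multipleSeries (M := M)]
  · rw [← Finset.Ico_add_one_right_eq_Icc,
      ← Finset.prod_Ico_consecutive _ hn (show n ≤ M + 1 by omega),
      Finset.prod_eq_prod_Ico_succ_bot (show n < M + 1 by omega), ← mul_assoc]
    congr 1
    · rw [succCountSeries, map_mul, map_prod, map_multipleSeries]
      congr 1
      · refine Finset.prod_congr rfl fun i hi => ?_
        rw [map_multipleSeries]
        congr 1
        ext1 c
        simp [partWeight, (Finset.mem_Ico.1 hi).2]
      · congr 1
        ext1 c
        simp [partWeight]
    · rw [show Finset.Ico (n + 1) (M + 1) = Finset.Ioc n M by ext; simp]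
      refine Finset.prod_congr rfl fun i hi => ?_
      have hi' := Finset.mem_Ioc.1 hi
      congr 1
      ext1 c
      rw [partWeight, if_neg (by omega), if_neg (by omega), if_pos (by omega)]
  · intro i h1 h2
    simp only [partWeight]
    split_ifs <;> simp
  · exact fun i hi c => partWeight_eq_zero _ hnM hi _

theorem coeff_succCountSeries_mul_boxSeries (m N n : ℕ) (hn : 1 ≤ n) (hnN : n ≤ N) :
    PowerSeries.coeff m (succCountSeries n * boxSeries n n (N + 1 - n)) =
      ∑ π ∈ (partitionsUpTo m (N + 1)).filter
        (fun π => Multiset.card (π.parts.filter (fun i => n < i)) = n),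
      ((π.parts.count n : ℤ) + 1) := by
  rw [boxSeries, ← polyCoeff_map_C_mul, show n + (N + 1 - n) = N + 1 by omega,
    ← genFun_partWeight n (N + 1) hn (by omega), coeff_polyCoeff,
    coeff_genFun_eq_sum_partitionsUpTo (fun i hi c => partWeight_eq_zero _ (by omega) hi c),
    Polynomial.finsetSum_coeff, Finset.sum_filter]
  refine Finset.sum_congr rfl fun π hπ => ?_
  rw [prod_partWeight _ _ (mem_partitionsUpTo.1 hπ),
    show ((π.parts.count n : Polynomial ℤ) + 1) = Polynomial.C ((π.parts.count n : ℤ) + 1) by simp,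
    Polynomial.coeff_C_mul, Polynomial.coeff_X_pow]
  simp only [eq_comm (a := n), mul_ite, mul_one, mul_zero]

theorem coeff_succCountSeries (m n : ℕ) (hn : 1 ≤ n) :
    PowerSeries.coeff m (succCountSeries n) =
      ∑ π ∈ partitionsUpTo m n, ((π.parts.count n : ℤ) + 1) := by
  -- With `M = n` no part is marked, so only `z ^ 0` survives.
  have h := congrArg (polyCoeff 0) (genFun_partWeight n n hn le_rfl)
  rw [Finset.Ioc_self, Finset.prod_empty, polyCoeff_map_C_mul, polyCoeff_one, if_pos rfl,
    mul_one] at h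
  rw [← h, coeff_polyCoeff,
    coeff_genFun_eq_sum_partitionsUpTo (fun i hi c => partWeight_eq_zero _ le_rfl hi c),
    Polynomial.finsetSum_coeff]
  refine Finset.sum_congr rfl fun π hπ => ?_
  have hπ' := mem_partitionsUpTo.1 hπ
  rw [prod_partWeight _ _ hπ', Multiset.filter_eq_nil.2 fun i hi => (hπ' i hi).not_gt,
    Multiset.card_zero, pow_zero, mul_one,
    show ((π.parts.count n : Polynomial ℤ) + 1) = Polynomial.C ((π.parts.count n : ℤ) + 1) by simp,
    Polynomial.coeff_C_zero]

theorem coeff_prod_multipleSeries_one (m n : ℕ) :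
    PowerSeries.coeff m (∏ i ∈ Finset.Icc 1 n, multipleSeries (fun _ => (1 : ℤ)) i) =
      ∑ _π ∈ partitionsUpTo m n, (1 : ℤ) := by
  have h := genFun_eq_prod_multipleSeries (R := ℤ) (f := fun i _ => if i ≤ n then 1 else 0)
    (M := n) (fun i _ h => if_pos h) (fun i h _ => if_neg (by omega))
  have h' : ∏ i ∈ Finset.Icc 1 n, multipleSeries (fun _ => (1 : ℤ)) i =
      ∏ i ∈ Finset.Icc 1 n, multipleSeries (fun _ => if i ≤ n then (1 : ℤ) else 0) i :=
    Finset.prod_congr rfl fun i hi => by simp [(Finset.mem_Icc.1 hi).2]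
  rw [h', ← h, coeff_genFun_eq_sum_partitionsUpTo (fun i h _ => if_neg h.not_ge)]
  refine Finset.sum_congr rfl fun π hπ => Finset.prod_eq_one fun i hi => if_pos ?_
  exact mem_partitionsUpTo.1 hπ i (by simpa using hi)

/-- Among partitions with parts at most `n`, only those with largest part exactly `n` contain `n`.
-/
theorem lptUpTo_eq_sum {m : ℕ} (hm : 1 ≤ m) (N : ℕ) :
    lptUpTo m N = ∑ n ∈ Finset.Icc 1 N, ∑ π ∈ partitionsUpTo m n, π.parts.count n := by
  have h : ∀ n ∈ Finset.Icc 1 N, ∑ π ∈ partitionsUpTo m n, π.parts.count n =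
      ∑ π ∈ partitionsUpTo m N, if largestPart π = n then π.parts.count n else 0 := by
    intro n hn
    have hsub : partitionsUpTo m n ⊆ partitionsUpTo m N := fun π hπ =>
      mem_partitionsUpTo.2 fun i hi =>
        (mem_partitionsUpTo.1 hπ i hi).trans (Finset.mem_Icc.1 hn).2
    rw [← Finset.sum_subset hsub]
    · refine Finset.sum_congr rfl fun π hπ => ?_
      split_ifs with h
      · rfl
      · have hle : largestPart π ≤ n := (Finset.mem_filter.1 hπ).2
        refine Multiset.count_eq_zero_of_notMem fun hmem => h (le_antisymm hle ?_)
        exact Multiset.le_sup hmem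
    · intro π _ hπ
      rw [if_neg]
      exact fun h => hπ (Finset.mem_filter.2 ⟨Finset.mem_univ _, h.le⟩)
  rw [Finset.sum_congr rfl h, Finset.sum_comm, lptUpTo]
  refine Finset.sum_congr rfl fun π hπ => ?_
  rw [Finset.sum_ite_eq, if_pos]
  refine Finset.mem_Icc.2 ⟨?_, (Finset.mem_filter.1 hπ).2⟩
  obtain ⟨i, hi⟩ : ∃ i, i ∈ π.parts := by
    refine Multiset.exists_mem_of_ne_zero fun h0 => ?_
    have := π.parts_sum
    rw [h0, Multiset.sum_zero] at this
    omega
  exact (π.parts_pos hi).trans_le (Multiset.le_sup hi)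

theorem divisorCountUpTo_eq_coeff {m : ℕ} (hm : 1 ≤ m) (N : ℕ) :
    (divisorCountUpTo m N : ℤ) = PowerSeries.coeff m
      (∑ n ∈ Finset.Icc 1 N, (multipleSeries (fun _ => (1 : ℤ)) n - 1)) := by
  have hset : m.divisors.filter (fun k => k ≤ N) = (Finset.Icc 1 N).filter (fun k => k ∣ m) := by
    ext k
    simp only [Finset.mem_filter, Nat.mem_divisors, Finset.mem_Icc]
    constructor
    · rintro ⟨⟨h1, h2⟩, h3⟩
      exact ⟨⟨Nat.pos_of_dvd_of_pos h1 hm, h3⟩, h1⟩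
    · rintro ⟨⟨_, h3⟩, h1⟩
      exact ⟨⟨h1, by omega⟩, h3⟩
  rw [divisorCountUpTo, hset, Finset.card_filter, map_sum]
  push_cast
  refine Finset.sum_congr rfl fun n _ => ?_
  simp [multipleSeries, PowerSeries.coeff_one, show m ≠ 0 by omega]

/-! ### Transfer of (i) to power series, and the conclusion -/

theorem qShiftedFactorial_self_eq_prod_Icc {K : Type*} [Field K] (q : K) (n : ℕ) :
    qShiftedFactorial q q n = ∏ i ∈ Finset.Icc 1 n, (1 - q ^ i) := by
  induction n with
  | zero => simp [qShiftedFactorial]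
  | succ n ih => rw [qShiftedFactorial_self_succ, ih, Finset.prod_Icc_succ_top (by omega)]

/-- The identity `sum_div_add_sum_qBinomial` as one between generating functions. -/
theorem sum_multipleSeries_add_sum_boxSeries {K : Type*} [Field K]
    (ι : PowerSeries ℤ →+* K) (hinj : Function.Injective ι) (N : ℕ) :
    ∑ n ∈ Finset.Icc 1 N, (multipleSeries (fun _ => (1 : ℤ)) n - 1) +
        ∑ n ∈ Finset.Icc 1 N, succCountSeries n * boxSeries n n (N + 1 - n) =
      ∑ n ∈ Finset.Icc 1 N, (succCountSeries n -
        ∏ i ∈ Finset.Icc 1 n, multipleSeries (fun _ => (1 : ℤ)) i) := by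
  set q := ι PowerSeries.X with hqdef
  -- `X ^ k` and `1` have different constant coefficients.
  have hq : ∀ k : ℕ, 1 ≤ k → q ^ k ≠ 1 := by
    intro k hk h
    rw [hqdef, ← map_pow, ← map_one ι] at h
    have := congrArg PowerSeries.constantCoeff (hinj h)
    simp [show k ≠ 0 by omega] at this
  have hne : ∀ k : ℕ, 1 ≤ k → 1 - q ^ k ≠ 0 := fun k hk => sub_ne_zero.2 (hq k hk).symm
  have hone : ∀ i : ℕ, 1 ≤ i → ι (multipleSeries (fun _ => (1 : ℤ)) i) = (1 - q ^ i)⁻¹ := by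
    intro i hi
    refine eq_inv_of_mul_eq_one_left ?_
    have := congrArg ι (multipleSeries_one_mul (R := ℤ) (show i ≠ 0 by omega))
    simpa only [map_mul, map_sub, map_one, map_pow] using this
  have hprod : ∀ n : ℕ, ι (∏ i ∈ Finset.Icc 1 n, multipleSeries (fun _ => (1 : ℤ)) i) =
      (qShiftedFactorial q q n)⁻¹ := by
    intro n
    rw [map_prod, qShiftedFactorial_self_eq_prod_Icc, ← Finset.prod_inv_distrib]
    exact Finset.prod_congr rfl fun i hi => hone i (Finset.mem_Icc.1 hi).1
  have hsucc : ∀ n : ℕ, 1 ≤ n →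
      ι (succCountSeries n) = (qShiftedFactorial q q n * (1 - q ^ n))⁻¹ := by
    intro n hn
    have h : succCountSeries n * (1 - PowerSeries.X ^ n) =
        ∏ i ∈ Finset.Icc 1 n, multipleSeries (fun _ => (1 : ℤ)) i := by
      obtain ⟨k, rfl⟩ := Nat.exists_eq_add_of_le' hn
      rw [succCountSeries, mul_assoc, multipleSeries_succ_mul (by omega),
        Finset.prod_Icc_succ_top (by omega), Finset.Ico_add_one_right_eq_Icc]
    have h' := congrArg ι h
    rw [hprod, map_mul, map_sub, map_one, map_pow] at h'
    rw [mul_inv, ← h', mul_assoc, mul_inv_cancel₀ (hne n hn), mul_one]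
  have hfac (n : ℕ) : qShiftedFactorial q q n ≠ 0 :=
    qShiftedFactorial_self_ne_zero (N := n) (fun k h1 _ => hq k h1) le_rfl
  apply hinj
  have key := sum_div_add_sum_qBinomial N (q := q) fun k h1 _ => hq k h1
  simp only [map_add, map_sum]
  convert key using 1
  · congr 1
    · refine Finset.sum_congr rfl fun n hn => ?_
      have := hne n (Finset.mem_Icc.1 hn).1
      rw [map_sub, map_one, hone n (Finset.mem_Icc.1 hn).1]
      field_simp
      ring
    · refine Finset.sum_congr rfl fun n hn => ?_
      have hn' := Finset.mem_Icc.1 hn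
      -- The box has `n` parts and width `N + 1 - n`, so the upper index is `N` for every `n`.
      rw [map_mul, hsucc n hn'.1, map_boxSeries ι rfl hq,
        show N + 1 - n + n - 1 = N by omega, div_eq_mul_inv]
      ring
  · refine Finset.sum_congr rfl fun n hn => ?_
    have hn' := (Finset.mem_Icc.1 hn).1
    have := hne n hn'
    have := hfac n
    rw [map_sub, hsucc n hn', hprod]
    field_simp
    ring

theorem divisorCountUpTo_add_weightedCount {m : ℕ} (hm : 1 ≤ m) (N : ℕ) :
    divisorCountUpTo m N + weightedCount m N = lptUpTo m N := by
  have h := congrArg (PowerSeries.coeff m) (sum_multipleSeries_add_sum_boxSeries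
    (algebraMap (PowerSeries ℤ) (FractionRing (PowerSeries ℤ))) (IsFractionRing.injective _ _) N)
  have hw : (weightedCount m N : ℤ) = ∑ n ∈ Finset.Icc 1 N,
      PowerSeries.coeff m (succCountSeries n * boxSeries n n (N + 1 - n)) := by
    rw [weightedCount, Nat.cast_sum]
    refine Finset.sum_congr rfl fun n hn => ?_
    have hn' := Finset.mem_Icc.1 hn
    rw [coeff_succCountSeries_mul_boxSeries m N n hn'.1 hn'.2]
    push_cast
    rfl
  have hl : (lptUpTo m N : ℤ) = ∑ n ∈ Finset.Icc 1 N, PowerSeries.coeff m (succCountSeries n -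
      ∏ i ∈ Finset.Icc 1 n, multipleSeries (fun _ => (1 : ℤ)) i) := by
    rw [lptUpTo_eq_sum hm, Nat.cast_sum]
    refine Finset.sum_congr rfl fun n hn => ?_
    rw [map_sub, coeff_succCountSeries m n (Finset.mem_Icc.1 hn).1,
      coeff_prod_multipleSeries_one, ← Finset.sum_sub_distrib]
    simp
  rw [map_add, ← divisorCountUpTo_eq_coeff hm, map_sum, map_sum, ← hw, ← hl] at h
  exact_mod_cast h

theorem mainTheorem12 (N : ℕ) :
    (∀ {K : Type*} [Field K] (q : K), (∀ k : ℕ, 1 ≤ k → k ≤ N → q ^ k ≠ 1) →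
      ∑ n ∈ Finset.Icc 1 N, q ^ n / (1 - q ^ n) +
          ∑ n ∈ Finset.Icc 1 N,
            qBinomial q N n * (q ^ (n * (n + 1)) / (qShiftedFactorial q q n * (1 - q ^ n))) =
        ∑ n ∈ Finset.Icc 1 N, q ^ n / ((1 - q ^ n) * qShiftedFactorial q q n)) ∧
    (∀ m : ℕ, 1 ≤ m → divisorCountUpTo m N + weightedCount m N = lptUpTo m N) :=
  ⟨fun _ hq => sum_div_add_sum_qBinomial N hq,
    fun _ hm => divisorCountUpTo_add_weightedCount hm N⟩
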